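/- Let $X$ be a normal projective variety of dimension at least $2$ over a finite field $\mathbb{F}_q$ (an integral normal closed subscheme of some $\mathbb{P}^m_{\mathbb{F}_q}$), let $\mathcal{S} \subseteq X(\mathbb{F}_q)$ be a set of $\mathbb{F}_q$-rational points, and let $C_1, \dots, C_a$ be irreducible curves on $X$ defined over $\mathbb{F}_q$ (integral closed subschemes of dimension $1$) such that $\mathcal{S} \subseteq \bigcup_{i=1}^a C_i$ and $\#(C_i \cap \mathcal{S}) \le N$ for all $i$. Let $\mathcal{L}$ be a line bundle on $X$ defined over $\mathbb{F}_q$ such that $$0 \le \mathcal{L}\cdot C_i \le \eta \le N \quad \text{for all } i,$$ where $\mathcal{L}\cdot C_i$ is the degree over $\mathbb{F}_q$ of $\mathcal{L}|_{C_i}$, that is, the common degree $\sum_p \operatorname{ord}_p(s)\,[\kappa(p):\mathbb{F}_q]$ of the divisors of the nonzero rational sections $s$ of $\mathcal{L}|_{C_i}$. Suppose $\Gamma(X,\mathcal{L}) \ne 0$ and let $$\ell = \max_{0 \ne f \in \Gamma(X,\mathcal{L})} \#\{i : C_i \subseteq Z(f)\},$$ where $Z(f)$ is the zero locus of $f$.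 Let $C(X,\mathcal{L};\mathcal{S}) \subseteq \mathbb{F}_q^{\mathcal{S}}$ be the image of the linear map $\Gamma(X,\mathcal{L}) \to \mathbb{F}_q^{\mathcal{S}}$ that sends $f$ to the vector of its values at the points $P \in \mathcal{S}$ with respect to chosen local trivializations of $\mathcal{L}$ at these points. If this code is nonzero, then, for every choice of the trivializations, its minimum distance $d$ satisfies $$d \ge \#\mathcal{S} - \ell N - (a - \ell)\eta.$$ -/

import Mathlib

open AlgebraicGeometry CategoryTheory TopologicalSpace

universe u

namespace CurveCode

noncomputable section

/-! ### Projective and normal schemes over a field -/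

attribute [local instance] MvPolynomial.gradedAlgebra

/-- The projective space `ℙ^m` over a field `k`. -/
abbrev ProjSpace (k : Type u) [Field k] (m : ℕ) : Scheme.{u} :=
  Proj (MvPolynomial.homogeneousSubmodule (Fin (m + 1)) k)

/-- The structure morphism `ℙ^m ⟶ Spec k`. -/
def projSpaceHom (k : Type u) [Field k] (m : ℕ) : ProjSpace k m ⟶ Spec (CommRingCat.of k) :=
  Proj.toSpecZero (MvPolynomial.homogeneousSubmodule (Fin (m + 1)) k) ≫
    Spec.map (CommRingCat.ofHom
      (algebraMap k (MvPolynomial.homogeneousSubmodule (Fin (m + 1)) k 0)))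

/-- A `k`-scheme `π : X ⟶ Spec k` is projective if it is isomorphic over `k` to a closed subscheme
of some projective space `ℙ^m`. -/
class IsProjective {k : Type u} [Field k] {X : Scheme.{u}} (π : X ⟶ Spec (CommRingCat.of k)) :
    Prop where
  exists_closedImmersion : ∃ (m : ℕ) (j : X ⟶ ProjSpace k m),
    IsClosedImmersion j ∧ j ≫ projSpaceHom k m = π

/-- A scheme is normal if its local rings are integrally closed domains. -/
class IsNormal (X : Scheme.{u}) : Prop where
  isDomain_stalk : ∀ x : X, IsDomain (X.presheaf.stalk x)
  isIntegrallyClosed_stalk : ∀ x : X, IsIntegrallyClosed (X.presheaf.stalk x)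

theorem isLocallyNoetherian_projSpace (k : Type u) [Field k] (m : ℕ) :
    IsLocallyNoetherian (ProjSpace k m) := by
  let A := MvPolynomial.homogeneousSubmodule (Fin (m + 1)) k
  have : IsScalarTower k (A 0) (MvPolynomial (Fin (m + 1)) k) :=
    ⟨fun c x y ↦ smul_mul_assoc c (x : MvPolynomial (Fin (m + 1)) k) y⟩
  have : Algebra.FiniteType (A 0) (MvPolynomial (Fin (m + 1)) k) :=
    Algebra.FiniteType.of_restrictScalars_finiteType k (A 0) _
  have hsurj : Function.Surjective (algebraMap k (A 0)) := by
    rintro ⟨p, hp⟩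
    refine ⟨p.coeff 0, Subtype.ext ?_⟩
    exact (MvPolynomial.totalDegree_eq_zero_iff_eq_C.mp
      (Nat.le_zero.mp (MvPolynomial.IsHomogeneous.totalDegree_le hp))).symm
  have : IsNoetherianRing (A 0) := isNoetherianRing_of_surjective _ _ _ hsurj
  exact LocallyOfFiniteType.isLocallyNoetherian (Proj.toSpecZero A)

theorem IsProjective.isLocallyNoetherian {k : Type u} [Field k] {X : Scheme.{u}}
    (π : X ⟶ Spec (CommRingCat.of k)) [h : IsProjective π] : IsLocallyNoetherian X := by
  obtain ⟨m, j, hj, -⟩ := h.exists_closedImmersion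
  have := isLocallyNoetherian_projSpace k m
  exact LocallyOfFiniteType.isLocallyNoetherian j

/-! ### Line bundles and their sections -/

section LineBundle

variable {X : Scheme.{u}}

/-- Restriction of sections of an `𝒪_X`-module. -/
def res (M : X.Modules) {U V : X.Opens} (h : V ≤ U) (s : Γ(M, U)) : Γ(M, V) :=
  M.presheaf.map (homOfLE h).op s

/-- A local trivialization of `M` at the point `x`: an open neighbourhood `U` of `x` and a section
`e` of `M` over `U` such that `r ↦ r • e` is an isomorphism `𝒪_U ≅ M|_U`. -/
structure LocalTriv (M : X.Modules) (x : X) where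
  U : X.Opens
  mem : x ∈ U
  e : Γ(M, U)
  bijective : ∀ (V : X.Opens) (h : V ≤ U),
    Function.Bijective (fun r : Γ(X, V) ↦ (r • res M h e : Γ(M, V)))

/-- A line bundle is a locally free sheaf of rank one. -/
def IsLineBundle (M : X.Modules) : Prop :=
  ∀ x : X, Nonempty (LocalTriv M x)

namespace LocalTriv

variable {M : X.Modules} {x : X}

/-- For `V ⊆ U` the isomorphism `M(V) ≅ 𝒪_X(V)` given by a local trivialization on `U`:
`s ↦ g`, where `s = g • e`. -/
def coord (t : LocalTriv M x) {V : X.Opens} (h : V ≤ t.U) (s : Γ(M, V)) : Γ(X, V) :=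
  (Equiv.ofBijective _ (t.bijective V h)).symm s

theorem coord_smul (t : LocalTriv M x) {V : X.Opens} (h : V ≤ t.U) (s : Γ(M, V)) :
    t.coord h s • res M h t.e = s :=
  (Equiv.ofBijective _ (t.bijective V h)).apply_symm_apply s

theorem coord_eq (t : LocalTriv M x) {V : X.Opens} (h : V ≤ t.U) {s : Γ(M, V)} {g : Γ(X, V)}
    (hg : g • res M h t.e = s) : t.coord h s = g :=
  (t.bijective V h).1 ((t.coord_smul h s).trans hg.symm)

/-- The value at `x`, in the residue field `κ(x)`, of a global section of `M` with respect to a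
local trivialization at `x`. -/
def value (t : LocalTriv M x) (f : Γ(M, ⊤)) : X.residueField x :=
  X.evaluation t.U x t.mem (t.coord le_rfl (res M le_top f))

end LocalTriv

/-- The set of zeros `Z(f)` of a global section `f` of a line bundle. -/
def zeroLocus (M : X.Modules) (f : Γ(M, ⊤)) : Set X :=
  {x | ∀ t : LocalTriv M x, t.value f = 0}

end LineBundle

/-! ### Degrees of line bundles on curves and intersection numbers -/

section Degree

variable {C : Scheme.{u}} [IsIntegral C]

/-- A nonzero rational section of a line bundle `M` on an integral scheme `C`: a nonzero section
of `M` over a nonempty open subset. -/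
structure RatSection (M : C.Modules) where
  V : C.Opens
  nonempty : (V : Set C).Nonempty
  s : Γ(M, V)
  ne_zero : s ≠ 0

theorem RatSection.genericPoint_mem {M : C.Modules} (s : RatSection M) {p : C}
    (t : LocalTriv M p) : genericPoint C ∈ t.U ⊓ s.V :=
  ⟨((genericPoint_spec C).mem_open_set_iff t.U.isOpen).mpr ⟨p, trivial, t.mem⟩,
    ((genericPoint_spec C).mem_open_set_iff s.V.isOpen).mpr
      (by simpa using s.nonempty)⟩

/-- The rational function on `C` that represents a rational section in a local trivialization. -/
def RatSection.localFunction {M : C.Modules} (s : RatSection M) {p : C} (t : LocalTriv M p) :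
    C.functionField :=
  C.presheaf.germ (t.U ⊓ s.V) (genericPoint C) (s.genericPoint_mem t)
    (t.coord inf_le_left (res M inf_le_right s.s))

open Classical in
/-- The order of vanishing at `p` of a nonzero rational section of a line bundle: the order of the
rational function representing it in a local trivialization at `p`. (It does not depend on the
trivialization; on a line bundle the second case does not occur.) -/
def RatSection.ordAt [IsLocallyNoetherian C] {M : C.Modules} (s : RatSection M) (p : C) : ℤ :=
  if h : Nonempty (LocalTriv M p) then Scheme.ord (s.localFunction h.some) p else 0

/-- The degree `∑_p ord_p(s) [κ(p) : k]` of the divisor of a nonzero rational section of a line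
bundle on an integral curve `C` over `k`. -/
def RatSection.degree {k : Type u} [Field k] [IsLocallyNoetherian C]
    (π : C ⟶ Spec (CommRingCat.of k)) {M : C.Modules} (s : RatSection M) : ℤ :=
  ∑ᶠ p : C, s.ordAt p * (π.residueDegree p : ℤ)

/-- The degree of a line bundle on a projective integral curve over `k`, that is, the degree of
the divisors of its nonzero rational sections. All these divisors have the same degree, so that
the supremum is over a one-element set of integers. -/
def degree {k : Type u} [Field k] [IsLocallyNoetherian C] (π : C ⟶ Spec (CommRingCat.of k))
    (M : C.Modules) : EReal :=
  ⨆ s : RatSection M, (((s.degree π : ℤ) : ℝ) : EReal)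

end Degree

/-- An irreducible curve on `X`: a closed integral subscheme of dimension one. -/
structure Curve (X : Scheme.{u}) where
  C : Scheme.{u}
  ι : C ⟶ X
  isClosedImmersion : IsClosedImmersion ι
  isIntegral : IsIntegral C
  dim_eq_one : topologicalKrullDim C = 1

/-- The set of points of a curve on `X`. -/
def Curve.support {X : Scheme.{u}} (C : Curve X) : Set X := Set.range C.ι

theorem Curve.isLocallyNoetherian {X : Scheme.{u}} (C : Curve X) [IsLocallyNoetherian X] :
    IsLocallyNoetherian C.C :=
  have := C.isClosedImmersion
  LocallyOfFiniteType.isLocallyNoetherian C.ι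

/-- The intersection number `L · C` of a line bundle `L` and a curve `C` on a projective
`k`-scheme: the degree over `k` of the line bundle `L|_C`. -/
def intersectionNumber {k : Type u} [Field k] {X : Scheme.{u}} (π : X ⟶ Spec (CommRingCat.of k))
    [IsProjective π] (L : X.Modules) (C : Curve X) : EReal :=
  haveI := C.isIntegral
  haveI := IsProjective.isLocallyNoetherian π
  haveI := C.isLocallyNoetherian
  degree (C.ι ≫ π) ((Scheme.Modules.pullback C.ι).obj L)

/-! ### The code `C(X, L; S)` -/

section Code

variable {k : Type u} [Field k] {X : Scheme.{u}} (π : X ⟶ Spec (CommRingCat.of k))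

/-- The constants as functions on `X`. -/
def constFun : k →+* Γ(X, ⊤) :=
  ((Scheme.ΓSpecIso (CommRingCat.of k)).inv ≫ π.appTop).hom

/-- The inclusion of `k` in the residue field of a point of `X`. -/
def constAt (P : X) : k →+* X.residueField P :=
  (X.evaluation ⊤ P trivial).hom.comp (constFun π)

/-- The set `X(k)` of `k`-rational points: the points with residue field `k`. -/
def rationalPoints : Set X := {P | Function.Bijective (constAt π P)}

/-- For a rational point `P`, the identification of the residue field with `k`. -/
def toBase {P : X} (hP : P ∈ rationalPoints π) : X.residueField P ≃+* k :=
  (RingEquiv.ofBijective (constAt π P) hP).symm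

/-- The germ map `Γ(X, L) → k^S` defined by local trivializations of `L` at the points of `S`. -/
def germMap (L : X.Modules) (S : Finset X) (hS : (S : Set X) ⊆ rationalPoints π)
    (t : ∀ P : S, LocalTriv L P.1) (f : Γ(L, ⊤)) : S → k :=
  fun P ↦ toBase π (hS P.2) ((t P).value f)

theorem LocalTriv.value_add {M : X.Modules} {x : X} (t : LocalTriv M x) (f g : Γ(M, ⊤)) :
    t.value (f + g) = t.value f + t.value g := by
  unfold LocalTriv.value
  rw [← map_add]
  congr 1
  apply t.coord_eq
  rw [add_smul, t.coord_smul, t.coord_smul]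
  exact (map_add (M.presheaf.map (homOfLE le_top).op).hom f g).symm

theorem LocalTriv.value_smul {M : X.Modules} {x : X} (t : LocalTriv M x) (r : Γ(X, ⊤))
    (f : Γ(M, ⊤)) : t.value (r • f) = X.evaluation ⊤ x trivial r * t.value f := by
  unfold LocalTriv.value
  have h : X.evaluation ⊤ x trivial r
      = X.evaluation t.U x t.mem (X.presheaf.map (homOfLE le_top).op r) := by
    simp only [Scheme.evaluation, CommRingCat.comp_apply]
    rw [TopCat.Presheaf.germ_res_apply]
  rw [h, ← map_mul]
  congr 1
  apply t.coord_eq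
  rw [mul_smul, t.coord_smul]
  exact (M.map_smul (homOfLE le_top) r f).symm

/-- The code `C(X, L; S)`: the image of the germ map, a linear code in `k^S`. -/
def code (L : X.Modules) (S : Finset X) (hS : (S : Set X) ⊆ rationalPoints π)
    (t : ∀ P : S, LocalTriv L P.1) : Submodule k (S → k) where
  carrier := Set.range (germMap π L S hS t)
  add_mem' := by
    rintro _ _ ⟨f, rfl⟩ ⟨g, rfl⟩
    exact ⟨f + g, funext fun P ↦ by simp [germMap, LocalTriv.value_add]⟩
  zero_mem' := by
    refine ⟨(0 : Γ(X, ⊤)) • (0 : Γ(L, ⊤)), funext fun P ↦ ?_⟩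
    simp only [germMap, LocalTriv.value_smul, map_zero, zero_mul, Pi.zero_apply]
  smul_mem' := by
    rintro c _ ⟨f, rfl⟩
    refine ⟨constFun π c • f, funext fun P ↦ ?_⟩
    simp only [germMap, LocalTriv.value_smul, map_mul, Pi.smul_apply, smul_eq_mul]
    congr 1
    exact (RingEquiv.ofBijective (constAt π P.1) (hS P.2)).symm_apply_apply c

open Classical in
/-- `d` is the minimum distance of the linear code `C`: the least Hamming distance between two
different codewords. (The zero code has no minimum distance.) -/
def IsMinDist {ι : Type*} [Fintype ι] (C : Submodule k (ι → k)) (d : ℕ) : Prop :=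
  IsLeast {w | ∃ c ∈ C, ∃ c' ∈ C, c ≠ c' ∧ hammingDist c c' = w} d

end Code

end

end CurveCode

/-!
Two different codewords come from sections whose difference is a nonzero section `f`, and they
agree exactly at the points of `S` in the zero locus `Z` of `f`. These points lie on the curves
`C i`. The at most `ℓ` curves inside `Z` carry at most `N` of them each. On any other curve `C i`
the pullback of `f` is a nonzero section of `L|_{C i}`: its divisor is effective, and each rational
zero contributes at least `1` to its degree `L · C i ≤ η`. Hence `#(S ∩ Z) ≤ ℓ N + (a - ℓ) η`.

Local trivializations have to be pulled back along `C i ⟶ X` although the sections of a pulled back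
module have no explicit description. A section `e` trivializes `M` over `U` if and only if, for
every module `K` on `U`, evaluation at `e` identifies the morphisms from `M` to the pushforward of
`K` with the sections `K(U)`, and this property passes through the adjunction between pullback and
pushforward.
-/

namespace CurveCode

noncomputable section

section Modules

variable {X : Scheme.{u}}

theorem res_self (M : X.Modules) {U : X.Opens} (h : U ≤ U) (s : Γ(M, U)) : res M h s = s := by
  change M.presheaf.map (𝟙 _) s = s
  simp

theorem res_res (M : X.Modules) {U V W : X.Opens} (h : V ≤ U) (h' : W ≤ V) (s : Γ(M, U)) :
    res M h' (res M h s) = res M (h'.trans h) s := by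
  change (M.presheaf.map _ ≫ M.presheaf.map _) s = _
  rw [← M.presheaf.map_comp]
  rfl

theorem res_zero (M : X.Modules) {U V : X.Opens} (h : V ≤ U) : res M h (0 : Γ(M, U)) = 0 :=
  map_zero (M.presheaf.map (homOfLE h).op).hom

theorem res_smul (M : X.Modules) {U V : X.Opens} (h : V ≤ U) (r : Γ(X, U)) (s : Γ(M, U)) :
    res M h (r • s) = X.presheaf.map (homOfLE h).op r • res M h s :=
  M.map_smul (homOfLE h) r s

theorem app_res {M N : X.Modules} (φ : M ⟶ N) {U V : X.Opens} (h : V ≤ U) (s : Γ(M, U)) :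
    φ.app V (res M h s) = res N h (φ.app U s) :=
  ConcreteCategory.congr_hom (φ.mapPresheaf.naturality (homOfLE h).op) s

theorem bijective_res_of_eq (M : X.Modules) {U V : X.Opens} (h : V ≤ U) (hUV : V = U) :
    Function.Bijective (res M h) := by
  subst hUV
  rw [show res M h = id from funext (res_self M h)]
  exact Function.bijective_id

/-- The structure sheaf `𝒪_X` as a module over itself; its sections over `U` are `Γ(X, U)`. -/
abbrev structureModule (X : Scheme.{u}) : X.Modules := SheafOfModules.unit X.ringCatSheaf

theorem smul_res_one {U : X.Opens} (r : Γ(X, U)) :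
    (r • res (structureModule X) le_top (1 : Γ(X, ⊤)) : Γ(structureModule X, U)) = r :=
  (congrArg (r * ·) (map_one (X.presheaf.map (homOfLE (le_top : U ≤ ⊤)).op).hom)).trans
    (mul_one r)

theorem app_structureModule {M : X.Modules} (φ : structureModule X ⟶ M) (U : X.Opens)
    (r : Γ(X, U)) : φ.app U r = r • res M le_top (φ.app ⊤ (1 : Γ(X, ⊤))) :=
  calc
    φ.app U r = φ.app U (r • res (structureModule X) le_top (1 : Γ(X, ⊤))) :=
      congrArg (φ.app U) (smul_res_one r).symm
    _ = r • φ.app U (res (structureModule X) le_top (1 : Γ(X, ⊤))) := φ.app_smul r _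
    _ = r • res M le_top (φ.app ⊤ (1 : Γ(X, ⊤))) := congrArg (r • ·) (app_res φ le_top _)

theorem bijective_app_one (M : X.Modules) :
    Function.Bijective (fun φ : structureModule X ⟶ M ↦ (φ.app ⊤ (1 : Γ(X, ⊤)) : Γ(M, ⊤))) := by
  refine ⟨fun φ ψ h ↦ ?_, fun s ↦ ?_⟩
  · ext U r
    exact (app_structureModule φ U r).trans
      ((congrArg (fun s ↦ (show Γ(X, U) from r) • res M le_top s) h).trans
        (app_structureModule ψ U r).symm)
  · let restrictions : M.val.sections := PresheafOfModules.sectionsMk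
      (fun U ↦ (res M (U := ⊤) (V := U.unop) le_top s : Γ(M, U.unop)))
      (fun U V f ↦ res_res M le_top f.unop.le s)
    refine ⟨(SheafOfModules.unitHomEquiv M).symm restrictions, ?_⟩
    have h := congrArg (fun t ↦ t.val (.op ⊤))
      ((SheafOfModules.unitHomEquiv M).apply_symm_apply restrictions)
    exact h.trans (res_self M le_rfl s)

end Modules

section Generators

variable {X : Scheme.{u}}

/-- The section `e` generates `M` freely over `U`: multiplication by `e` is an isomorphism
`𝒪_U ≅ M|_U`. -/
def IsGenerator (M : X.Modules) {U : X.Opens} (e : Γ(M, U)) : Prop :=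
  ∀ (V : X.Opens) (h : V ≤ U),
    Function.Bijective (fun r : Γ(X, V) ↦ (r • res M h e : Γ(M, V)))

theorem isGenerator_iff_isIso (M : X.Modules) (φ : structureModule X ⟶ M) :
    IsGenerator M (U := ⊤) (φ.app ⊤ (1 : Γ(X, ⊤))) ↔ IsIso φ := by
  have bijective_iff (U : X.Opens) : Function.Bijective (φ.app U) ↔
      Function.Bijective (fun r : Γ(X, U) ↦ r • res M le_top (φ.app ⊤ (1 : Γ(X, ⊤)))) :=
    iff_of_eq (congrArg Function.Bijective (funext (app_structureModule φ U)))
  rw [Scheme.Modules.Hom.isIso_iff_isIso_app]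
  simp only [ConcreteCategory.isIso_iff_bijective, bijective_iff]
  exact ⟨fun h U ↦ h U le_top, fun h U _ ↦ h U⟩

/-- A section of `M` over `U`, regarded as a global section of the restriction of `M` to `U`. -/
def restrictSection (M : X.Modules) {U : X.Opens} (e : Γ(M, U)) : Γ(M.restrict U.ι, ⊤) :=
  res M (U := U) (V := U.ι ''ᵁ ⊤) (by simp) e

theorem res_restrictSection (M : X.Modules) {U : X.Opens} (e : Γ(M, U)) {V : U.toScheme.Opens}
    (h : U.ι ''ᵁ V ≤ U) : res (M.restrict U.ι) le_top (restrictSection M e) = res M h e :=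
  res_res M (by simp) (Scheme.Hom.image_mono U.ι le_top) e

theorem smul_res_restrictSection (M : X.Modules) {U : X.Opens} (e : Γ(M, U))
    {V : U.toScheme.Opens} (h : U.ι ''ᵁ V ≤ U) (r : Γ(U, V)) :
    (r • res (M.restrict U.ι) le_top (restrictSection M e) : Γ(M.restrict U.ι, V)) =
      ((U.ι.appIso V).inv r • res M h e : Γ(M, U.ι ''ᵁ V)) :=
  (Scheme.Modules.smul_restrictAppIso_hom_apply U.ι M V r _).trans
    (congrArg (fun s : Γ(M, U.ι ''ᵁ V) ↦ (U.ι.appIso V).inv r • s) (res_restrictSection M e h))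

theorem isGenerator_restrictSection_iff (M : X.Modules) {U : X.Opens} (e : Γ(M, U)) :
    IsGenerator (M.restrict U.ι) (restrictSection M e) ↔ IsGenerator M e := by
  have bijective_iff (V : U.toScheme.Opens) (h : U.ι ''ᵁ V ≤ U) :
      Function.Bijective (fun r : Γ(U, V) ↦ (r • res (M.restrict U.ι) le_top
        (restrictSection M e) : Γ(M.restrict U.ι, V))) ↔
      Function.Bijective (fun r : Γ(X, U.ι ''ᵁ V) ↦ (r • res M h e : Γ(M, U.ι ''ᵁ V))) := by
    rw [funext (smul_res_restrictSection M e h)]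
    exact Function.Bijective.of_comp_iff (fun r : Γ(X, U.ι ''ᵁ V) ↦ r • res M h e)
      ((ConcreteCategory.isIso_iff_bijective (U.ι.appIso V).inv).mp inferInstance)
  refine ⟨fun he V hV ↦ ?_, fun he V _ ↦ ?_⟩
  · obtain ⟨V', rfl⟩ : ∃ V', V = U.ι ''ᵁ V' :=
      ⟨U.ι ⁻¹ᵁ V, by simpa [Scheme.Hom.image_preimage_eq_opensRange_inf] using hV⟩
    exact (bijective_iff V' hV).mp (he V' le_top)
  · have hV : U.ι ''ᵁ V ≤ U := by simpa using U.ι.image_mono (le_top : V ≤ ⊤)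
    exact (bijective_iff V hV).mpr (he _ hV)

theorem restrictAdjunction_homEquiv_app {M : X.Modules} {U : X.Opens} {K : U.toScheme.Modules}
    (ψ : M.restrict U.ι ⟶ K) (e : Γ(M, U)) :
    ((Scheme.Modules.restrictAdjunction U.ι).homEquiv M K ψ).app U e =
      res K (le_top : U.ι ⁻¹ᵁ U ≤ ⊤) (ψ.app ⊤ (restrictSection M e)) := by
  rw [← app_res, res_restrictSection M e (U.ι.image_preimage_le U), Adjunction.homEquiv_unit]
  rfl

theorem isGenerator_iff_bijective_app (M : X.Modules) {U : X.Opens} (e : Γ(M, U)) :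
    IsGenerator M e ↔ ∀ K : U.toScheme.Modules, Function.Bijective
      (fun χ : M ⟶ (Scheme.Modules.pushforward U.ι).obj K ↦ χ.app U e) := by
  obtain ⟨φ, hφ⟩ := (bijective_app_one (M.restrict U.ι)).2 (restrictSection M e)
  dsimp only at hφ
  rw [← isGenerator_restrictSection_iff, ← hφ, isGenerator_iff_isIso,
    isIso_iff_coyoneda_map_bijective]
  refine forall_congr' fun K ↦ ?_
  have hres : Function.Bijective (res K (le_top : U.ι ⁻¹ᵁ U ≤ ⊤)) :=
    bijective_res_of_eq K _ (by simp)
  rw [← (bijective_app_one K).of_comp_iff', ← hres.of_comp_iff',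
    ← Function.Bijective.of_comp_iff _
      ((Scheme.Modules.restrictAdjunction U.ι).homEquiv M K).bijective]
  refine iff_of_eq (congrArg _ (funext fun ψ ↦ ?_))
  exact (congrArg (fun s ↦ res K le_top (ψ.app ⊤ s)) hφ).trans
    (restrictAdjunction_homEquiv_app ψ e).symm

theorem bijective_app_iff_of_iso {M K K' : X.Modules} (α : K ≅ K') {U : X.Opens} (e : Γ(M, U)) :
    Function.Bijective (fun χ : M ⟶ K ↦ χ.app U e) ↔
      Function.Bijective (fun χ : M ⟶ K' ↦ χ.app U e) := by
  have hα : Function.Bijective (α.hom.app U) :=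
    (ConcreteCategory.isIso_iff_bijective _).mp inferInstance
  have hcomp : Function.Bijective (fun χ : M ⟶ K ↦ χ ≫ α.hom) :=
    (isIso_iff_yoneda_map_bijective α.hom).mp inferInstance M
  rw [← hα.of_comp_iff', ← Function.Bijective.of_comp_iff _ hcomp]
  rfl

end Generators

section Pullback

variable {X Y : Scheme.{u}} (f : Y ⟶ X) (M : X.Modules)

/-- The pullback `f^* s`, over the preimage of `U`, of a section `s` of `M` over `U`. -/
def pullbackSection {U : X.Opens} (s : Γ(M, U)) :
    Γ((Scheme.Modules.pullback f).obj M, f ⁻¹ᵁ U) :=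
  ((Scheme.Modules.pullbackPushforwardAdjunction f).unit.app M).app U s

theorem pullbackSection_smul {U : X.Opens} (r : Γ(X, U)) (s : Γ(M, U)) :
    pullbackSection f M (r • s) = f.app U r • pullbackSection f M s :=
  ((Scheme.Modules.pullbackPushforwardAdjunction f).unit.app M).app_smul r s

theorem pullbackSection_res {U V : X.Opens} (h : V ≤ U) (s : Γ(M, U)) :
    pullbackSection f M (res M h s) = res _ (f.preimage_mono h) (pullbackSection f M s) :=
  app_res ((Scheme.Modules.pullbackPushforwardAdjunction f).unit.app M) h s

/-- The two ways around the square formed by `f : Y ⟶ X` and its restriction `f ⁻¹ᵁ U ⟶ U` give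
the same pushforward. -/
def pushforwardRestrictIso (U : X.Opens) (N : (f ⁻¹ᵁ U).toScheme.Modules) :
    (Scheme.Modules.pushforward f).obj ((Scheme.Modules.pushforward (f ⁻¹ᵁ U).ι).obj N) ≅
      (Scheme.Modules.pushforward U.ι).obj ((Scheme.Modules.pushforward (f ∣_ U)).obj N) :=
  (Scheme.Modules.pushforwardComp (f ⁻¹ᵁ U).ι f ≪≫
    Scheme.Modules.pushforwardCongr (morphismRestrict_ι f U).symm ≪≫
    (Scheme.Modules.pushforwardComp (f ∣_ U) U.ι).symm).app N

variable {M}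

theorem IsGenerator.pullback {U : X.Opens} {e : Γ(M, U)} (he : IsGenerator M e) :
    IsGenerator _ (pullbackSection f M e) := by
  rw [isGenerator_iff_bijective_app] at he ⊢
  intro N
  have happ := (bijective_app_iff_of_iso (pushforwardRestrictIso f U N) e).mpr
    (he ((Scheme.Modules.pushforward (f ∣_ U)).obj N))
  exact happ.comp ((Scheme.Modules.pullbackPushforwardAdjunction f).homEquiv M _).bijective

/-- The pullback of a local trivialization. -/
def LocalTriv.pullback {y : Y} (t : LocalTriv M (f y)) :
    LocalTriv ((Scheme.Modules.pullback f).obj M) y where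
  U := f ⁻¹ᵁ t.U
  mem := t.mem
  e := pullbackSection f M t.e
  bijective := IsGenerator.pullback f t.bijective

theorem IsLineBundle.pullback (hM : IsLineBundle M) :
    IsLineBundle ((Scheme.Modules.pullback f).obj M) :=
  fun y ↦ ⟨(hM (f y)).some.pullback f⟩

theorem LocalTriv.coord_pullback {y : Y} (t : LocalTriv M (f y)) {V : X.Opens} (h : V ≤ t.U)
    (s : Γ(M, V)) :
    (t.pullback f).coord (V := f ⁻¹ᵁ V) (f.preimage_mono h) (pullbackSection f M s) =
      f.app V (t.coord h s) := by
  apply coord_eq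
  conv_rhs => rw [← t.coord_smul h s, pullbackSection_smul, pullbackSection_res]
  rfl

theorem LocalTriv.value_pullback {y : Y} (t : LocalTriv M (f y)) (s : Γ(M, ⊤)) :
    (t.pullback f).value (pullbackSection f M s) = f.residueFieldMap y (t.value s) := by
  unfold LocalTriv.value
  rw [Scheme.evaluation_naturality_apply f y t.mem, ← t.coord_pullback f le_rfl,
    pullbackSection_res]
  rfl

end Pullback

section Trivializations

variable {X : Scheme.{u}} {M : X.Modules}

namespace LocalTriv

variable {x y : X} (t : LocalTriv M x) (t' : LocalTriv M y)

instance : Nonempty t.U := ⟨⟨x, t.mem⟩⟩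

/-- A local trivialization at `x`, regarded as one at another point `y` of its domain. -/
def moveTo (hy : y ∈ t.U) : LocalTriv M y where
  U := t.U
  mem := hy
  e := t.e
  bijective := t.bijective

theorem coord_eq_zero_iff {V : X.Opens} (h : V ≤ t.U) (s : Γ(M, V)) : t.coord h s = 0 ↔ s = 0 := by
  constructor
  · intro h0
    rw [← t.coord_smul h s, h0, zero_smul]
  · rintro rfl
    exact t.coord_eq h (zero_smul _ _)

theorem coord_res {V W : X.Opens} (h : V ≤ t.U) (h' : W ≤ V) (s : Γ(M, V)) :
    t.coord (h'.trans h) (CurveCode.res M h' s) = X.presheaf.map (homOfLE h').op (t.coord h s) := by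
  apply coord_eq
  conv_rhs => rw [← t.coord_smul h s]
  rw [res_smul, res_res]

theorem coord_smul_section {V : X.Opens} (h : V ≤ t.U) (r : Γ(X, V)) (s : Γ(M, V)) :
    t.coord h (r • s) = r * t.coord h s := by
  apply coord_eq
  rw [mul_smul, t.coord_smul]

/-- The transition function over `V` from the trivialization `t'` to the trivialization `t`:
multiplication by it turns coordinates with respect to `t'` into coordinates with respect to `t`. -/
def transition {V : X.Opens} (h : V ≤ t.U) (h' : V ≤ t'.U) : Γ(X, V) :=
  t.coord h (CurveCode.res M h' t'.e)

theorem coord_eq_transition_mul {V : X.Opens} (h : V ≤ t.U) (h' : V ≤ t'.U) (s : Γ(M, V)) :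
    t.coord h s = t.transition t' h h' * t'.coord h' s := by
  conv_lhs => rw [← t'.coord_smul h' s]
  rw [coord_smul_section, mul_comm, transition]

theorem isUnit_transition {V : X.Opens} (h : V ≤ t.U) (h' : V ≤ t'.U) :
    IsUnit (t.transition t' h h') := by
  refine IsUnit.of_mul_eq_one (t'.transition t h' h) ?_
  calc
    t.transition t' h h' * t'.transition t h' h = t.coord h (CurveCode.res M h t.e) :=
      (t.coord_eq_transition_mul t' h h' _).symm
    _ = 1 := t.coord_eq h (one_smul _ _)

theorem transition_res {V W : X.Opens} (h : V ≤ t.U) (h' : V ≤ t'.U) (i : W ≤ V) :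
    t.transition t' (i.trans h) (i.trans h') =
      X.presheaf.map (homOfLE i).op (t.transition t' h h') := by
  rw [transition, transition, ← t.coord_res h i, res_res]

theorem value_eq_evaluation_coord {V : X.Opens} (h : V ≤ t.U) (hx : x ∈ V) (f : Γ(M, ⊤)) :
    t.value f = X.evaluation V x hx (t.coord h (CurveCode.res M le_top f)) := by
  rw [value, ← res_res M (le_top : t.U ≤ ⊤) h, t.coord_res le_rfl h]
  simp only [Scheme.evaluation, CommRingCat.comp_apply, TopCat.Presheaf.germ_res_apply]

theorem value_eq_zero_iff (t t' : LocalTriv M x) (f : Γ(M, ⊤)) :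
    t.value f = 0 ↔ t'.value f = 0 := by
  have hx : x ∈ t.U ⊓ t'.U := ⟨t.mem, t'.mem⟩
  rw [t.value_eq_evaluation_coord inf_le_left hx, t'.value_eq_evaluation_coord inf_le_right hx,
    t.coord_eq_transition_mul t' inf_le_left inf_le_right, map_mul]
  exact ((t.isUnit_transition t' inf_le_left inf_le_right).map _).mul_right_eq_zero

theorem mem_zeroLocus_iff (f : Γ(M, ⊤)) : x ∈ zeroLocus M f ↔ t.value f = 0 :=
  ⟨fun hx ↦ hx t, fun hf t' ↦ (t'.value_eq_zero_iff t f).mpr hf⟩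

theorem value_sub (f g : Γ(M, ⊤)) : t.value (f - g) = t.value f - t.value g := by
  rw [eq_sub_iff_add_eq, ← value_add, sub_add_cancel]

theorem value_zero : t.value (0 : Γ(M, ⊤)) = 0 := by
  rw [← sub_self 0, value_sub, sub_self]

end LocalTriv

theorem mem_zeroLocus_pullbackSection_iff {Y : Scheme.{u}} (f : Y ⟶ X) (hM : IsLineBundle M)
    (s : Γ(M, ⊤)) (y : Y) :
    y ∈ zeroLocus ((Scheme.Modules.pullback f).obj M) (pullbackSection f M s) ↔
      f y ∈ zeroLocus M s := by
  obtain ⟨t⟩ := hM (f y)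
  refine ((t.pullback f).mem_zeroLocus_iff _).trans (Iff.trans ?_ (t.mem_zeroLocus_iff s).symm)
  rw [← map_eq_zero (f.residueFieldMap y).hom]
  exact iff_of_eq (congrArg (· = 0) (t.value_pullback f s))

end Trivializations

section RationalSections

variable {C : Scheme.{u}} [IsIntegral C] {M : C.Modules}

theorem eq_zero_of_res_eq_zero (hM : IsLineBundle M) {V W : C.Opens} (h : V ≤ W)
    (hV : (V : Set C).Nonempty) (s : Γ(M, W)) (hs : res M h s = 0) : s = 0 := by
  have locally_zero (q : W) : ∃ (U : C.Opens) (i : U ≤ W), q.1 ∈ U ∧ res M i s = 0 := by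
    obtain ⟨t⟩ := hM q.1
    refine ⟨t.U ⊓ W, inf_le_right, ⟨t.mem, q.2⟩, ?_⟩
    rw [← t.coord_eq_zero_iff inf_le_left]
    have : Nonempty (t.U ⊓ W ⊓ V : C.Opens) :=
      (nonempty_preirreducible_inter (t.U ⊓ W).isOpen V.isOpen ⟨q.1, t.mem, q.2⟩ hV).to_subtype
    apply map_injective_of_isIntegral C (homOfLE (inf_le_left : t.U ⊓ W ⊓ V ≤ t.U ⊓ W))
    rw [map_zero, ← t.coord_res inf_le_left inf_le_left, t.coord_eq_zero_iff, res_res,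
      ← res_res M h inf_le_right, hs, res_zero]
  choose U i hq hz using locally_zero
  refine TopCat.Sheaf.eq_of_locally_eq' ⟨M.presheaf, M.isSheaf⟩ U W (fun q ↦ homOfLE (i q))
    (fun x hx ↦ Opens.mem_iSup.mpr ⟨⟨x, hx⟩, hq _⟩) _ _
    fun q ↦ (hz q).trans (res_zero M (i q)).symm

namespace RatSection

variable (s : RatSection M) {p : C} (t : LocalTriv M p)

instance : Nonempty (t.U ⊓ s.V : C.Opens) := ⟨⟨_, s.genericPoint_mem t⟩⟩

/-- A nonzero global section as a rational section. -/
abbrev ofGlobal (s : Γ(M, ⊤)) (hs : s ≠ 0) : RatSection M where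
  V := ⊤
  nonempty := ⟨genericPoint C, trivial⟩
  s := s
  ne_zero := hs

theorem coord_ne_zero (hM : IsLineBundle M) {V : C.Opens} [Nonempty V] (h : V ≤ t.U)
    (h' : V ≤ s.V) : t.coord h (res M h' s.s) ≠ 0 := by
  rw [Ne, t.coord_eq_zero_iff]
  exact fun h0 ↦ s.ne_zero (eq_zero_of_res_eq_zero hM h' (Set.nonempty_coe_sort.mp ‹_›) _ h0)

theorem localFunction_eq_germToFunctionField {V : C.Opens} [Nonempty V] (h : V ≤ t.U)
    (h' : V ≤ s.V) :
    s.localFunction t = C.germToFunctionField V (t.coord h (res M h' s.s)) := by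
  rw [localFunction, Scheme.germToFunctionField, ← res_res M inf_le_right (le_inf h h'),
    t.coord_res inf_le_left (le_inf h h'), TopCat.Presheaf.germ_res_apply]

theorem localFunction_eq_transition_mul (t' : LocalTriv M p) [Nonempty (t.U ⊓ t'.U : C.Opens)] :
    s.localFunction t = C.germToFunctionField (t.U ⊓ t'.U)
      (t.transition t' inf_le_left inf_le_right) * s.localFunction t' := by
  have : Nonempty (t.U ⊓ t'.U ⊓ s.V : C.Opens) :=
    ⟨⟨_, ⟨(s.genericPoint_mem t).1, (s.genericPoint_mem t').1⟩, (s.genericPoint_mem t).2⟩⟩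
  have hV : t.U ⊓ t'.U ⊓ s.V ≤ t.U ⊓ t'.U := inf_le_left
  rw [s.localFunction_eq_germToFunctionField t (hV.trans inf_le_left) inf_le_right,
    s.localFunction_eq_germToFunctionField t' (hV.trans inf_le_right) inf_le_right,
    t.coord_eq_transition_mul t' (hV.trans inf_le_left) (hV.trans inf_le_right), map_mul,
    t.transition_res t' inf_le_left inf_le_right hV]
  congr 1
  exact C.presheaf.germ_res_apply (homOfLE hV) _ _ _

variable [IsLocallyNoetherian C]

theorem ordAt_eq_ord_localFunction : s.ordAt p = Scheme.ord (s.localFunction t) p := by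
  have h : Nonempty (LocalTriv M p) := ⟨t⟩
  have hp : p ∈ h.some.U ⊓ t.U := ⟨h.some.mem, t.mem⟩
  have : Nonempty (h.some.U ⊓ t.U : C.Opens) := ⟨⟨p, hp⟩⟩
  have hu := h.some.isUnit_transition t inf_le_left (inf_le_right : h.some.U ⊓ t.U ≤ t.U)
  rw [ordAt, dif_pos h, s.localFunction_eq_transition_mul _ t]
  obtain h0 | h0 := eq_or_ne (s.localFunction t) 0
  · rw [h0, mul_zero]
  · rw [Scheme.ord_mul (hu.map (C.germToFunctionField _).hom).ne_zero h0,
      Scheme.ord_of_isUnit hu hp, zero_add]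

end RatSection

end RationalSections

section OrderOfVanishing

theorem ordFrac_eq_one_iff_isUnit {R : Type*} [CommRing R] [IsDomain R] [IsNoetherianRing R]
    [Ring.KrullDimLE 1 R] {K : Type*} [Field K] [Algebra R K] [IsFractionRing R K] {x : R}
    (hx : x ≠ 0) : Ring.ordFrac R (algebraMap R K x) = 1 ↔ IsUnit x := by
  refine ⟨fun h ↦ ?_, fun h ↦ Ring.ordFrac_of_isUnit h⟩
  have hnz := mem_nonZeroDivisors_of_ne_zero hx
  obtain ⟨n, hn⟩ := ENat.ne_top_iff_exists.mp (Ring.ord_ne_top hnz)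
  rw [Ring.ordFrac_eq_ord R hx, Ring.ordMonoidWithZeroHom_eq_coe R hnz hn.symm,
    ← WithZero.coe_one, WithZero.coe_inj, ofAdd_eq_one, Nat.cast_eq_zero] at h
  rwa [h, Nat.cast_zero, eq_comm, Ring.ord, Module.length_eq_zero_iff,
    Submodule.Quotient.subsingleton_iff, Ideal.span_singleton_eq_top] at hn

variable {C : Scheme.{u}} [IsIntegral C] [IsLocallyNoetherian C] {U : C.Opens} [Nonempty U] {p : C}
  {g : Γ(C, U)}

theorem ord_germToFunctionField_nonneg (hp : p ∈ U) (hg : g ≠ 0) :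
    0 ≤ Scheme.ord (C.germToFunctionField U g) p := by
  have hone : Scheme.ord (1 : C.functionField) p = 0 := by
    simpa only [map_one] using Scheme.ord_of_isUnit (isUnit_one (M := Γ(C, U))) hp
  have hle := Scheme.ord_le_smul hp hg (1 : C.functionField)
  rwa [hone, Algebra.smul_def, mul_one] at hle

theorem ord_germToFunctionField_eq_zero_iff (hp : p ∈ U) (hp1 : Order.coheight p = 1)
    (hg : g ≠ 0) :
    Scheme.ord (C.germToFunctionField U g) p = 0 ↔ C.evaluation U p hp g ≠ 0 := by
  have : Ring.KrullDimLE 1 (C.presheaf.stalk p) := krullDimLE_of_coheight_le hp1.le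
  have hgerm : C.presheaf.germ U p hp g ≠ 0 :=
    (map_ne_zero_iff _ (germ_injective_of_isIntegral C p hp)).mpr hg
  rw [Scheme.ord_eq_iff hp1 ((map_ne_zero_iff _ (Scheme.germToFunctionField_injective C U)).mpr hg),
    ← Scheme.algebraMap_germ_eq_germToFunctionField _ hp,
    Scheme.evaluation_ne_zero_iff_mem_basicOpen, C.mem_basicOpen g p hp]
  exact ordFrac_eq_one_iff_isUnit hgerm

end OrderOfVanishing

section PointsOfCodimensionOne

variable {X : Scheme.{u}}

theorem eq_genericPoint_of_isMax [IrreducibleSpace X] {x : X} (hx : IsMax x) :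
    x = genericPoint X :=
  have hspec := genericPoint_specializes x
  ((Scheme.le_iff_specializes.mp (hx (Scheme.le_iff_specializes.mpr hspec))).antisymm hspec).eq

theorem coheight_le_topologicalKrullDim (x : X) :
    (Order.coheight x : WithBot ℕ∞) ≤ topologicalKrullDim X := by
  rw [← Order.coheight_orderIso (irreducibleSetEquivPoints (α := X)).symm x]
  exact Order.coheight_le_krullDim _

theorem coheight_eq_one_of_isClosed [IrreducibleSpace X] (hdim : topologicalKrullDim X = 1) {x : X}
    (hx : IsClosed {x}) : Order.coheight x = 1 := by
  refine le_antisymm ?_ (Order.one_le_iff_pos.mpr (Order.coheight_pos.mpr fun hmax ↦ ?_))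
  · exact_mod_cast hdim ▸ coheight_le_topologicalKrullDim x
  · have eq_x (y : X) : y = x :=
      (eq_genericPoint_of_isMax hmax ▸ genericPoint_specializes y : x ⤳ y).mem_closed hx rfl
    have : Subsingleton X := ⟨fun y z ↦ (eq_x y).trans (eq_x z).symm⟩
    have hdim0 := topologicalKrullDim_zero_of_discreteTopology X
    rw [hdim] at hdim0
    exact absurd hdim0 (by decide)

theorem eq_of_specializes_of_coheight_eq_one [IrreducibleSpace X] {x p : X} (h : x ⤳ p)
    (hp : Order.coheight p = 1) (hx : x ≠ genericPoint X) : x = p := by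
  by_contra hne
  have hlt : p < x := lt_of_le_not_ge (Scheme.le_iff_specializes.mpr h)
    fun h' ↦ hne (h.antisymm (Scheme.le_iff_specializes.mp h')).eq
  have hpos : 0 < Order.coheight x :=
    Order.coheight_pos.mpr fun hmax ↦ hx (eq_genericPoint_of_isMax hmax)
  have hle : Order.coheight x + 1 ≤ 1 := hp ▸ Order.coheight_add_one_le hlt
  exact absurd ((add_le_add_left (Order.one_le_iff_pos.mpr hpos) 1).trans hle) (by decide)

theorem finite_coheight_eq_one_compl [IrreducibleSpace X] [NoetherianSpace X] {D : X.Opens}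
    (hD : (D : Set X).Nonempty) : {p : X | Order.coheight p = 1 ∧ p ∉ D}.Finite := by
  obtain ⟨T, hTfin, hTclosed, hTirr, hT⟩ :=
    NoetherianSpace.exists_finite_set_isClosed_irreducible D.isOpen.isClosed_compl
  have := hTfin.to_subtype
  choose x hx using fun Z : T ↦ QuasiSober.sober (hTirr _ Z.2) (hTclosed _ Z.2)
  refine (Set.finite_range x).subset fun p ⟨hp1, hpD⟩ ↦ ?_
  obtain ⟨Z, hZ, hpZ⟩ : p ∈ ⋃₀ T := hT ▸ hpD
  refine ⟨⟨Z, hZ⟩, eq_of_specializes_of_coheight_eq_one ((hx _).specializes hpZ) hp1 fun h ↦ ?_⟩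
  have hxD : x ⟨Z, hZ⟩ ∈ (D : Set X)ᶜ := hT ▸ Set.mem_sUnion_of_mem (hx ⟨Z, hZ⟩).mem hZ
  exact hxD (h ▸ ((genericPoint_spec X).mem_open_set_iff D.isOpen).mpr (by simpa using hD))

end PointsOfCodimensionOne

namespace RatSection

variable {C : Scheme.{u}} [IsIntegral C] [IsLocallyNoetherian C] {M : C.Modules}

theorem finite_support_ordAt [CompactSpace C] (hM : IsLineBundle M) (s : RatSection M) :
    (Function.support s.ordAt).Finite := by
  have : IsNoetherian C := {}
  obtain ⟨t⟩ := hM (genericPoint C)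
  let g := t.coord (V := t.U ⊓ s.V) inf_le_left (res M inf_le_right s.s)
  have hg : g ≠ 0 := s.coord_ne_zero t hM inf_le_left inf_le_right
  have hD : (C.basicOpen g : Set C).Nonempty :=
    (C.basicOpen g).ne_bot_iff_nonempty.mp ((basicOpen_eq_bot_iff g).not.mpr hg)
  refine (finite_coheight_eq_one_compl hD).subset fun p hp ↦ ?_
  have hp1 : Order.coheight p = 1 := by
    obtain ⟨t'⟩ := hM p
    by_contra hp1
    exact hp (by rw [s.ordAt_eq_ord_localFunction t', Scheme.ord_eq_zero_of_coheight_neq_one hp1])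
  refine ⟨hp1, fun hpD ↦ hp ?_⟩
  have hpV : p ∈ t.U ⊓ s.V := C.basicOpen_le g hpD
  rw [s.ordAt_eq_ord_localFunction (t.moveTo hpV.1),
    s.localFunction_eq_germToFunctionField (t.moveTo hpV.1) inf_le_left inf_le_right]
  exact (ord_germToFunctionField_eq_zero_iff hpV hp1 hg).mpr
    ((C.evaluation_ne_zero_iff_mem_basicOpen p hpV g).mpr hpD)

theorem ordAt_ofGlobal (s : Γ(M, ⊤)) (hs : s ≠ 0) {p : C} (t : LocalTriv M p) :
    (ofGlobal s hs).ordAt p =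
      Scheme.ord (C.germToFunctionField t.U (t.coord le_rfl (res M le_top s))) p := by
  rw [ordAt_eq_ord_localFunction _ t, localFunction_eq_germToFunctionField _ t le_rfl le_top]

theorem ordAt_ofGlobal_nonneg (hM : IsLineBundle M) (s : Γ(M, ⊤)) (hs : s ≠ 0) (p : C) :
    0 ≤ (ofGlobal s hs).ordAt p := by
  obtain ⟨t⟩ := hM p
  rw [ordAt_ofGlobal s hs t]
  exact ord_germToFunctionField_nonneg t.mem ((ofGlobal s hs).coord_ne_zero t hM le_rfl le_top)

theorem one_le_ordAt_ofGlobal (hM : IsLineBundle M) (s : Γ(M, ⊤)) (hs : s ≠ 0) {p : C}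
    (hp1 : Order.coheight p = 1) (hp : p ∈ zeroLocus M s) : 1 ≤ (ofGlobal s hs).ordAt p := by
  obtain ⟨t⟩ := hM p
  refine Int.add_one_le_of_lt ((ordAt_ofGlobal_nonneg hM s hs p).lt_of_ne' fun h ↦ ?_)
  rw [ordAt_ofGlobal s hs t, ord_germToFunctionField_eq_zero_iff t.mem hp1
    ((ofGlobal s hs).coord_ne_zero t hM le_rfl le_top)] at h
  exact h (hp t)

end RatSection

section ProjectiveSchemes

attribute [local instance] MvPolynomial.gradedAlgebra

theorem algebraMap_homogeneousSubmodule_zero_surjective (σ R : Type*) [CommRing R] :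
    Function.Surjective (algebraMap R (MvPolynomial.homogeneousSubmodule σ R 0)) := by
  rintro ⟨p, hp⟩
  exact ⟨p.coeff 0, Subtype.ext (MvPolynomial.totalDegree_eq_zero_iff_eq_C.mp
    (Nat.le_zero.mp (MvPolynomial.IsHomogeneous.totalDegree_le hp))).symm⟩

theorem isProper_projSpaceHom (k : Type u) [Field k] (m : ℕ) : IsProper (projSpaceHom k m) := by
  let A := MvPolynomial.homogeneousSubmodule (Fin (m + 1)) k
  have : IsScalarTower k (A 0) (MvPolynomial (Fin (m + 1)) k) :=
    ⟨fun c x y ↦ smul_mul_assoc c (x : MvPolynomial (Fin (m + 1)) k) y⟩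
  have : Algebra.FiniteType (A 0) (MvPolynomial (Fin (m + 1)) k) :=
    Algebra.FiniteType.of_restrictScalars_finiteType k (A 0) _
  have : IsClosedImmersion (Spec.map (CommRingCat.ofHom (algebraMap k (A 0)))) :=
    IsClosedImmersion.spec_of_surjective _ (algebraMap_homogeneousSubmodule_zero_surjective _ k)
  exact inferInstanceAs (IsProper (Proj.toSpecZero A ≫ _))

theorem IsProjective.isProper {k : Type u} [Field k] {X : Scheme.{u}}
    (π : X ⟶ Spec (CommRingCat.of k)) [h : IsProjective π] : IsProper π := by
  obtain ⟨m, j, hj, rfl⟩ := h.exists_closedImmersion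
  have := isProper_projSpaceHom k m
  infer_instance

end ProjectiveSchemes

section RationalPoints

theorem residueFieldMap_surjective_of_isClosedImmersion {X Y : Scheme.{u}} (f : Y ⟶ X)
    [IsClosedImmersion f] (y : Y) : Function.Surjective (f.residueFieldMap y) := by
  intro a
  obtain ⟨b, rfl⟩ := Y.residue_surjective y a
  obtain ⟨c, rfl⟩ := f.stalkMap_surjective y b
  exact ⟨X.residue (f y) c, ConcreteCategory.congr_hom (Scheme.residue_residueFieldMap f y) c⟩

theorem isClosed_singleton_of_residueFieldMap_surjective {X Y : Scheme.{u}} (f : X ⟶ Y)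
    [LocallyOfFiniteType f] [JacobsonSpace Y] {x : X} (hx : IsClosed {f x})
    (h : Function.Surjective (f.residueFieldMap x)) : IsClosed {x} := by
  have : JacobsonSpace X := LocallyOfFiniteType.jacobsonSpace f
  have : IsClosedImmersion (Spec.map (f.residueFieldMap x)) :=
    IsClosedImmersion.spec_of_surjective _ h
  have : IsClosedImmersion (Y.fromSpecResidueField (f x)) :=
    isClosed_singleton_iff_isClosedImmersion.mp hx
  have : LocallyOfFiniteType (X.fromSpecResidueField x ≫ f) := by
    rw [← Scheme.Hom.SpecMap_residueFieldMap_fromSpecResidueField]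
    infer_instance
  exact isClosed_singleton_iff_locallyOfFiniteType.mpr (locallyOfFiniteType_of_comp _ f)

theorem residueDegree_eq_one_of_surjective {X Y : Scheme.{u}} (f : X ⟶ Y) {x : X}
    (h : Function.Surjective (f.residueFieldMap x)) : f.residueDegree x = 1 := by
  let := (f.residueFieldMap x).hom.toAlgebra
  exact Subalgebra.bot_eq_top_iff_finrank_eq_one.mp (Algebra.surjective_algebraMap_iff.mp h).symm

variable {k : Type u} [Field k] {X Y : Scheme.{u}} (f : Y ⟶ X) (π : X ⟶ Spec (CommRingCat.of k))

theorem constAt_comp (y : Y) (c : k) :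
    constAt (f ≫ π) y c = f.residueFieldMap y (constAt π (f y) c) :=
  (Scheme.evaluation_naturality_apply f y (V := ⊤) trivial (constFun π c)).symm

theorem mem_rationalPoints_comp [IsClosedImmersion f] {y : Y} (hy : f y ∈ rationalPoints π) :
    y ∈ rationalPoints (f ≫ π) := by
  refine ⟨(constAt (f ≫ π) y).injective, ?_⟩
  rw [funext (constAt_comp f π y)]
  exact (residueFieldMap_surjective_of_isClosedImmersion f y).comp hy.2

variable {π} {x : X}

theorem residueFieldMap_surjective_of_mem_rationalPoints (hx : x ∈ rationalPoints π) :
    Function.Surjective (π.residueFieldMap x) := by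
  intro a
  obtain ⟨c, rfl⟩ := hx.2 a
  exact ⟨_, Scheme.evaluation_naturality_apply π (V := ⊤) x trivial _⟩

theorem isClosed_singleton_of_mem_rationalPoints [LocallyOfFiniteType π]
    (hx : x ∈ rationalPoints π) : IsClosed {x} :=
  have : DiscreteTopology (Spec (CommRingCat.of k)) :=
    inferInstanceAs (DiscreteTopology (PrimeSpectrum k))
  isClosed_singleton_of_residueFieldMap_surjective π (isClosed_discrete _)
    (residueFieldMap_surjective_of_mem_rationalPoints hx)

end RationalPoints

section ZeroBound

variable {k : Type u} [Field k]

theorem RatSection.degree_le_degree {C : Scheme.{u}} [IsIntegral C] [IsLocallyNoetherian C]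
    (π : C ⟶ Spec (CommRingCat.of k)) {M : C.Modules} (s : RatSection M) :
    (((s.degree π : ℤ) : ℝ) : EReal) ≤ CurveCode.degree π M :=
  le_iSup (fun s : RatSection M ↦ (((s.degree π : ℤ) : ℝ) : EReal)) s

theorem ncard_le_degree_ofGlobal {C : Scheme.{u}} [IsIntegral C] [IsLocallyNoetherian C]
    (π : C ⟶ Spec (CommRingCat.of k)) [LocallyOfFiniteType π] [QuasiCompact π]
    (hdim : topologicalKrullDim C = 1) {M : C.Modules} (hM : IsLineBundle M) (s : Γ(M, ⊤))
    (hs : s ≠ 0) {T : Set C} (hT : T ⊆ rationalPoints π ∩ zeroLocus M s) :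
    (T.ncard : ℤ) ≤ (RatSection.ofGlobal s hs).degree π := by
  have : CompactSpace C := QuasiCompact.compactSpace_of_compactSpace π
  let term (p : C) : ℤ := (RatSection.ofGlobal s hs).ordAt p * (π.residueDegree p : ℤ)
  have term_nonneg (p : C) : 0 ≤ term p :=
    mul_nonneg (RatSection.ordAt_ofGlobal_nonneg hM s hs p) (Nat.cast_nonneg _)
  have one_le_term (p : C) (hp : p ∈ T) : 1 ≤ term p := by
    have hrat := (hT hp).1
    have hclosed := isClosed_singleton_of_mem_rationalPoints hrat
    have hdeg := residueDegree_eq_one_of_surjective π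
      (residueFieldMap_surjective_of_mem_rationalPoints hrat)
    simpa only [term, hdeg, Nat.cast_one, mul_one] using RatSection.one_le_ordAt_ofGlobal hM s hs
      (coheight_eq_one_of_isClosed hdim hclosed) (hT hp).2
  have hfin : (Function.support term).Finite :=
    ((RatSection.ofGlobal s hs).finite_support_ordAt hM).subset
      fun p hp ↦ left_ne_zero_of_mul hp
  have hsub : T ⊆ hfin.toFinset := fun p hp ↦
    hfin.mem_toFinset.mpr (zero_lt_one.trans_le (one_le_term p hp)).ne'
  lift T to Finset C using hfin.toFinset.finite_toSet.subset hsub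
  calc
    ((T : Set C).ncard : ℤ) = ∑ p ∈ T, 1 := by simp
    _ ≤ ∑ p ∈ T, term p := Finset.sum_le_sum one_le_term
    _ ≤ ∑ p ∈ hfin.toFinset, term p :=
      Finset.sum_le_sum_of_subset_of_nonneg (Finset.coe_subset.mp hsub) fun p _ _ ↦ term_nonneg p
    _ = (RatSection.ofGlobal s hs).degree π := (finsum_eq_sum term hfin).symm

theorem ncard_le_intersectionNumber {X : Scheme.{u}} (π : X ⟶ Spec (CommRingCat.of k))
    [IsProjective π] {L : X.Modules} (hL : IsLineBundle L) (C : Curve X) (f : Γ(L, ⊤))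
    (hf : ¬ C.support ⊆ zeroLocus L f) {T : Set X}
    (hT : T ⊆ rationalPoints π ∩ zeroLocus L f) :
    (((C.support ∩ T).ncard : ℝ) : EReal) ≤ intersectionNumber π L C := by
  have := C.isIntegral
  have := C.isClosedImmersion
  have := IsProjective.isLocallyNoetherian π
  have := C.isLocallyNoetherian
  have := IsProjective.isProper π
  have hM := hL.pullback C.ι
  have hs : pullbackSection C.ι L f ≠ 0 := by
    intro h0
    refine hf (Set.range_subset_iff.mpr fun q ↦ ?_)
    rw [← mem_zeroLocus_pullbackSection_iff C.ι hL, h0]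
    exact fun t ↦ t.value_zero
  have hT' : C.ι ⁻¹' T ⊆ rationalPoints (C.ι ≫ π) ∩ zeroLocus _ (pullbackSection C.ι L f) :=
    fun q hq ↦ ⟨mem_rationalPoints_comp C.ι π (hT hq).1,
      (mem_zeroLocus_pullbackSection_iff C.ι hL f q).mpr (hT hq).2⟩
  have hcard : (C.support ∩ T).ncard = (C.ι ⁻¹' T).ncard := by
    rw [Curve.support, Set.inter_comm, ← Set.image_preimage_eq_inter_range,
      Set.ncard_image_of_injective _ C.ι.isClosedEmbedding.injective]
  have hdeg := ncard_le_degree_ofGlobal (C.ι ≫ π) C.dim_eq_one hM _ hs hT'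
  rw [hcard]
  exact (EReal.coe_le_coe_iff.mpr (by exact_mod_cast hdeg)).trans
    (RatSection.degree_le_degree (C.ι ≫ π) _)

end ZeroBound

section Codes

theorem ncard_le_of_subset_iUnion {α ι : Type*} [Fintype ι] {A : ι → Set α} {S : Set α}
    (hSA : S ⊆ ⋃ i, A i) (I : Set ι) {N η : ℝ}
    (hN : ∀ i ∈ I, ((A i ∩ S).ncard : ℝ) ≤ N) (hη : ∀ i ∉ I, ((A i ∩ S).ncard : ℝ) ≤ η) :
    (S.ncard : ℝ) ≤ I.ncard * N + (Fintype.card ι - I.ncard) * η := by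
  classical
  lift I to Finset ι using I.toFinite
  have hcover : S.ncard ≤ ∑ i, (A i ∩ S).ncard := by
    conv_lhs => rw [← Set.inter_eq_right.mpr hSA, Set.iUnion_inter]
    exact Set.ncard_iUnion_le_of_fintype _
  calc
    (S.ncard : ℝ) ≤ ∑ i, ((A i ∩ S).ncard : ℝ) := by exact_mod_cast hcover
    _ = ∑ i ∈ I, ((A i ∩ S).ncard : ℝ) + ∑ i ∈ Iᶜ, ((A i ∩ S).ncard : ℝ) :=
      (Finset.sum_add_sum_compl I _).symm
    _ ≤ I.card • N + Iᶜ.card • η :=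
      add_le_add (Finset.sum_le_card_nsmul _ _ _ hN)
        (Finset.sum_le_card_nsmul _ _ _ fun i hi ↦ hη i (Finset.mem_compl.mp hi))
    _ = (I : Set ι).ncard * N + (Fintype.card ι - (I : Set ι).ncard) * η := by
      rw [Set.ncard_coe_finset, Finset.card_compl, nsmul_eq_mul, nsmul_eq_mul,
        Nat.cast_sub I.card_le_univ]

variable {k : Type u} [Field k] {X : Scheme.{u}} {π : X ⟶ Spec (CommRingCat.of k)}
  {L : X.Modules} {S : Finset X} {hS : (S : Set X) ⊆ rationalPoints π}
  {t : ∀ P : S, LocalTriv L P.1}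

theorem germMap_apply_eq_iff (f g : Γ(L, ⊤)) (P : S) :
    germMap π L S hS t f P = germMap π L S hS t g P ↔ P.1 ∈ zeroLocus L (f - g) := by
  rw [(t P).mem_zeroLocus_iff, LocalTriv.value_sub, sub_eq_zero, germMap, germMap,
    (toBase π (hS P.2)).injective.eq_iff]

open Classical in
theorem hammingDist_germMap (f g : Γ(L, ⊤)) :
    hammingDist (germMap π L S hS t f) (germMap π L S hS t g) =
      ((S : Set X) \ zeroLocus L (f - g)).ncard := by
  have hdiff : (S : Set X) \ zeroLocus L (f - g) =
      Subtype.val '' {P : S | germMap π L S hS t f P ≠ germMap π L S hS t g P} := by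
    ext P
    simp [germMap_apply_eq_iff, and_comm]
  rw [hdiff, Set.ncard_image_of_injective _ Subtype.val_injective, hammingDist,
    ← Set.ncard_coe_finset, Finset.coe_filter_univ]

theorem IsMinDist.exists_ncard_diff_zeroLocus_eq {d : ℕ} (hd : IsMinDist (code π L S hS t) d) :
    ∃ f : Γ(L, ⊤), f ≠ 0 ∧ ((S : Set X) \ zeroLocus L f).ncard = d := by
  classical
  obtain ⟨⟨_, ⟨f, rfl⟩, _, ⟨g, rfl⟩, hne, hdist⟩, -⟩ := hd
  exact ⟨f - g, fun h ↦ hne (by rw [sub_eq_zero.mp h]), (hammingDist_germMap f g).symm.trans hdist⟩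

end Codes

end

end CurveCode

theorem theorem3p3_general {k : Type u} [Field k] {X : Scheme.{u}}
    (π : X ⟶ Spec (CommRingCat.of k)) [CurveCode.IsProjective π]
    (S : Finset X) (hS : (S : Set X) ⊆ CurveCode.rationalPoints π)
    {ι : Type*} [Fintype ι] (C : ι → CurveCode.Curve X) (hSC : (S : Set X) ⊆ ⋃ i, (C i).support)
    (N η : ℝ) (hN : ∀ i, (((C i).support ∩ (S : Set X)).ncard : ℝ) ≤ N)
    (L : X.Modules) (hL : CurveCode.IsLineBundle L)
    (hLC : ∀ i, CurveCode.intersectionNumber π L (C i) ≤ (η : EReal)) (hηN : η ≤ N) (ℓ : ℕ)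
    (hℓ : IsGreatest {n : ℕ | ∃ f : Γ(L, ⊤), f ≠ 0 ∧
      {i | (C i).support ⊆ CurveCode.zeroLocus L f}.ncard = n} ℓ)
    (t : ∀ P : S, CurveCode.LocalTriv L P.1)
    (d : ℕ) (hd : CurveCode.IsMinDist (CurveCode.code π L S hS t) d) :
    (S.card : ℝ) - ℓ * N - (Fintype.card ι - ℓ) * η ≤ d := by
  obtain ⟨f, hf, hfd⟩ := hd.exists_ncard_diff_zeroLocus_eq
  set Z := CurveCode.zeroLocus L f
  have hinside : ({i | (C i).support ⊆ Z}.ncard : ℝ) ≤ ℓ := Nat.cast_le.mpr (hℓ.2 ⟨f, hf, rfl⟩)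
  have hzeros_N (i : ι) : (((C i).support ∩ (S ∩ Z)).ncard : ℝ) ≤ N := by
    refine le_trans (Nat.cast_le.mpr (Set.ncard_le_ncard ?_ ?_)) (hN i)
    · exact Set.inter_subset_inter_right _ Set.inter_subset_left
    · exact S.finite_toSet.inter_of_right _
  have hzeros_η (i : ι) (hi : ¬ (C i).support ⊆ Z) :
      (((C i).support ∩ (S ∩ Z)).ncard : ℝ) ≤ η :=
    EReal.coe_le_coe_iff.mp ((CurveCode.ncard_le_intersectionNumber π hL (C i) f hi
      (Set.inter_subset_inter_left Z hS)).trans (hLC i))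
  have hzeros := CurveCode.ncard_le_of_subset_iUnion (Set.inter_subset_left.trans hSC)
    {i | (C i).support ⊆ Z} (fun i _ ↦ hzeros_N i) hzeros_η
  have hsplit : (((S : Set X) ∩ Z).ncard : ℝ) + d = S.card := by
    rw [← hfd, ← Set.ncard_coe_finset S]
    exact_mod_cast Set.ncard_inter_add_ncard_sdiff_eq_ncard (S : Set X) Z S.finite_toSet
  nlinarith [mul_nonneg (sub_nonneg.mpr hinside) (sub_nonneg.mpr hηN)]

theorem theorem3p3 {k : Type u} [Field k] [Finite k] {X : Scheme.{u}}
    (π : X ⟶ Spec (CommRingCat.of k)) [CurveCode.IsProjective π] [IsIntegral X]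
    [CurveCode.IsNormal X] (hdim : 2 ≤ topologicalKrullDim X)
    (S : Finset X) (hS : (S : Set X) ⊆ CurveCode.rationalPoints π)
    {a : ℕ} (C : Fin a → CurveCode.Curve X) (hSC : (S : Set X) ⊆ ⋃ i, (C i).support)
    (N η : ℝ) (hN : ∀ i, (((C i).support ∩ (S : Set X)).ncard : ℝ) ≤ N)
    (L : X.Modules) (hL : CurveCode.IsLineBundle L)
    (hLC : ∀ i, 0 ≤ CurveCode.intersectionNumber π L (C i) ∧
      CurveCode.intersectionNumber π L (C i) ≤ (η : EReal))
    (hηN : η ≤ N)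
    (ℓ : ℕ)
    (hℓ : IsGreatest {n : ℕ | ∃ f : Γ(L, ⊤), f ≠ 0 ∧
      {i | (C i).support ⊆ CurveCode.zeroLocus L f}.ncard = n} ℓ)
    (t : ∀ P : S, CurveCode.LocalTriv L P.1)
    (d : ℕ) (hd : CurveCode.IsMinDist (CurveCode.code π L S hS t) d) :
    (S.card : ℝ) - ℓ * N - (a - ℓ) * η ≤ d := by
  simpa only [Fintype.card_fin] using
    theorem3p3_general π S hS C hSC N η hN L hL (fun i ↦ (hLC i).2) hηN ℓ hℓ t d hd
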